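/- Setting. There are $N\ge 2$ players $p_1,\dots,p_N$ and $N$ arms $a_1,\dots,a_N$; player $p_i$ owns arm $a_i$. An instance $\nu=(\nu_{k,j})_{k,j\in[N]}$ assigns to each player-arm pair a reward law with mean $U(k,j)\in[0,1]$; it has Bernoulli rewards if every $\nu_{k,j}$ is a law on $\{0,1\}$, and strict preferences if $U(k,j)\ne U(k,j')$ for all $k$ and $j\neq j'$. In each round every player proposes to at most one arm. If $p_k$ is the only player proposing to $a_j$, it receives an independent reward with law $\nu_{k,j}$; on a collision (or if it abstains) it receives $0$. A policy chooses for each horizon $T$ and each round the (random, possibly coordinated) proposals of the players as a function of the history of proposals and rewards. A matching $\mu$ is a bijection from players to arms; it is in the core if no coalition can reallocate the arms owned by its members among its members so that no member is worse off and some member is strictly better off. Under strict preferences there is exactly one such matching, $\mu^*$. The core regret of $p_i$ is $Reg_i(T;\nu,\pi)=T\,U(i,\mu^*(p_i))-\mathbb{E}_{\nu,\pi}\big[\sum_{t=1}^T X_i(t)\big]$, where $X_i(t)$ is the reward of $p_i$ in round $t$. A policy $\pi$ is uniformly consistent if for every Bernoulli instance $\nu$ with $N$ players and strict preferences, every player $p_i$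 and every $\alpha\in(0,1)$, $\limsup_{T\to\infty} Reg_i(T;\nu,\pi)/T^{\alpha}\le 0$. An instance with strict preferences is a single top trading cycle bandit (STTCB) if $\mu^*$ gives every player its top-ranked arm and there is a permutation $\sigma$ of $[N]$ with $\mu^*(p_{\sigma_k})=a_{\sigma_{k+1}}$ for $1\le k<N$ and $\mu^*(p_{\sigma_N})=a_{\sigma_1}$. The minimum preference gap $\Delta_{\min}$ of an instance is the least difference, over all players, between the utilities of two arms that are consecutive in the player's preference ranking. Statement. There is an absolute constant $c>0$ such that for every $N\ge 2$, every player $p_i$, $i\in[N]$, and every $\Delta\in\big(0,\tfrac{1}{2N}\big]$ there is an STTCB instance $\nu$ with $N$ players, Bernoulli rewards, strict preferences and $\Delta_{\min}=\Delta$ such that every uniformly consistent policy $\pi$ satisfies $$Reg_i(T;\nu,\pi)\ \ge\ c\,\frac{N\log T}{\Delta_{\min}^2}\qquad\text{for all sufficiently large } T .$$ -/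

import Mathlib

open MeasureTheory ProbabilityTheory Filter

noncomputable section

namespace HousingBandit

/-- An instance of the market: `ν i j` is the law of the reward of player `i` when it is matched
to arm `j`. Player `i` owns arm `i`. -/
abbrev Env (N : ℕ) := Fin N → Fin N → ProbabilityMeasure ℝ

/-- The laws on `{0, 1}`. -/
def bernoulliLaws : Set (ProbabilityMeasure ℝ) :=
  {m | ∃ p : unitInterval, (m : Measure ℝ) = bernoulliMeasure (1 : ℝ) 0 p}

/-- The utility matrix: mean rewards. -/
def utility {N : ℕ} (ν : Env N) (i j : Fin N) : ℝ := ∫ x, x ∂(ν i j : Measure ℝ)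

/-! ### Preferences, core, single top trading cycle, gaps -/

/-- All preferences of every player are distinct. -/
def StrictPrefs {N : ℕ} (U : Fin N → Fin N → ℝ) : Prop :=
  ∀ i, Function.Injective (U i)

/-- The matching `μ` (player `i` gets arm `μ i`) is in the core: no coalition `S` can reallocate
the arms that its members own among themselves so that no member is worse off and some member is
strictly better off. This is the (weak domination) core, which under strict preferences
consists of exactly one matching. -/
def IsCore {N : ℕ} (U : Fin N → Fin N → ℝ) (μ : Equiv.Perm (Fin N)) : Prop :=
  ¬ ∃ (S : Finset (Fin N)) (μ' : Equiv.Perm (Fin N)),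
      (∀ i ∈ S, μ' i ∈ S) ∧ (∀ i ∈ S, U i (μ i) ≤ U i (μ' i)) ∧ ∃ i ∈ S, U i (μ i) < U i (μ' i)

/-- Single top trading cycle: the core matching `μ` gives every player its unique top-ranked arm,
and there is an enumeration `σ` of the players such that `μ` sends `σ k` to the arm of `σ (k + 1)`
(cyclically). -/
def IsSTTCB {N : ℕ} (U : Fin N → Fin N → ℝ) (μ : Equiv.Perm (Fin N)) : Prop :=
  IsCore U μ ∧ (∀ i j, j ≠ μ i → U i j < U i (μ i)) ∧
    ∃ σ : Equiv.Perm (Fin N), ∀ k, μ (σ k) = σ (finRotate N k)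

/-- `r` lists the arms from the most to the least preferred one. -/
def IsRanking {N : ℕ} (u : Fin N → ℝ) (r : Equiv.Perm (Fin N)) : Prop :=
  StrictAnti fun k => u (r k)

/-- `Δ` is the minimum preference gap: the least difference, over all players, of the utilities of
two arms that are consecutive in the ranking of the player. -/
def IsMinGap {N : ℕ} (U : Fin N → Fin N → ℝ) (Δ : ℝ) : Prop :=
  IsLeast {δ | ∃ (i : Fin N) (r : Equiv.Perm (Fin N)), IsRanking (U i) r ∧
    ∃ k k' : Fin N, (k' : ℕ) = k + 1 ∧ δ = U i (r k) - U i (r k')} Δ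

/-! ### Interaction -/

/-- Proposals of all players in one round; `none` means that the player abstains. -/
def Profile (N : ℕ) := Fin N → Option (Fin N)

instance (N : ℕ) : MeasurableSpace (Profile N) := ⊤

instance (N : ℕ) : DiscreteMeasurableSpace (Profile N) := ⟨fun _ => trivial⟩

instance (N : ℕ) : Finite (Profile N) := inferInstanceAs (Finite (Fin N → Option (Fin N)))

/-- What happens in one round: proposals and rewards of all players. -/
abbrev Round (N : ℕ) := Profile N × (Fin N → ℝ)

/-- Histories of `t` rounds. -/
abbrev History (N t : ℕ) := Fin t → Round N

/-- A policy: `kernel T t` gives, for the horizon `T` and every history of `t` rounds, the law of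
the proposals in the next round. The whole history may be used and the players may coordinate. -/
structure Policy (N : ℕ) where
  kernel : ℕ → ∀ t : ℕ, Kernel (History N t) (Profile N)
  markov : ∀ T t, IsMarkovKernel (kernel T t)

attribute [instance] Policy.markov

open Classical in
/-- Law of the reward of player `i` under the proposals `a`: it is drawn from `ν i j` if `i` is the
only player who proposes to `j`, and it is `0` upon collision or abstention. -/
def rewardLaw {N : ℕ} (ν : Env N) (a : Profile N) (i : Fin N) : Measure ℝ :=
  match a i with
  | none => Measure.dirac 0
  | some j => if ∀ k, k ≠ i → a k ≠ some j then (ν i j : Measure ℝ) else Measure.dirac 0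

instance {N : ℕ} (ν : Env N) (a : Profile N) (i : Fin N) : IsProbabilityMeasure (rewardLaw ν a i) := by
  unfold rewardLaw
  split
  · infer_instance
  · split_ifs <;> infer_instance

/-- Given the proposals, the rewards of the players are independent. -/
def rewardKernel {N : ℕ} (ν : Env N) : Kernel (Profile N) (Fin N → ℝ) :=
  Kernel.ofFunOfCountable fun a => Measure.pi fun i => rewardLaw ν a i

instance {N : ℕ} (ν : Env N) : IsMarkovKernel (rewardKernel ν) :=
  ⟨fun a => by
    change IsProbabilityMeasure (Measure.pi fun i => rewardLaw ν a i)
    infer_instance⟩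

/-- Law of the next round given the history. -/
def stepKernel {N : ℕ} (ν : Env N) (π : Policy N) (T t : ℕ) : Kernel (History N t) (Round N) :=
  π.kernel T t ⊗ₖ Kernel.prodMkLeft (History N t) (rewardKernel ν)

instance {N : ℕ} (ν : Env N) (π : Policy N) (T t : ℕ) : IsMarkovKernel (stepKernel ν π T t) := by
  unfold stepKernel; infer_instance

/-- Append a round to a history. -/
def extend {N t : ℕ} (p : History N t × Round N) : History N (t + 1) :=
  Fin.snoc (α := fun _ => Round N) p.1 p.2

lemma measurable_extend {N t : ℕ} : Measurable (extend (N := N) (t := t)) := by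
  refine measurable_pi_lambda _ fun k => ?_
  refine Fin.lastCases ?_ (fun k => ?_) k
  · simpa [extend] using measurable_snd
  · simp only [extend, Fin.snoc_castSucc]
    exact (measurable_pi_apply k).comp measurable_fst

/-- Law of the first `t` rounds when `π` is run with horizon `T` on `ν`. -/
def law {N : ℕ} (ν : Env N) (π : Policy N) (T : ℕ) : (t : ℕ) → Measure (History N t)
  | 0 => Measure.dirac Fin.elim0
  | t + 1 => ((law ν π T t) ⊗ₘ (stepKernel ν π T t)).map extend

instance {N : ℕ} (ν : Env N) (π : Policy N) (T t : ℕ) : IsProbabilityMeasure (law ν π T t) := by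
  induction t with
  | zero => unfold law; infer_instance
  | succ t ih => unfold law; exact Measure.isProbabilityMeasure_map measurable_extend.aemeasurable

/-- The core regret of player `i` over `T` rounds, with respect to the core matching `μ`. -/
def coreRegret {N : ℕ} (ν : Env N) (μ : Equiv.Perm (Fin N)) (π : Policy N) (i : Fin N) (T : ℕ) : ℝ :=
  T * utility ν i (μ i) - ∫ h, ∑ t : Fin T, (h t).2 i ∂(law ν π T T)

/-- Uniform consistency over the instances with reward laws in `P` and strict preferences: the core
regret of every player is asymptotically at most `o (T ^ α)`, for every `α ∈ (0, 1)`. -/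
def UniformlyConsistent {N : ℕ} (P : Set (ProbabilityMeasure ℝ)) (π : Policy N) : Prop :=
  ∀ ν : Env N, (∀ i j, ν i j ∈ P) → StrictPrefs (utility ν) →
    ∀ μ, IsCore (utility ν) μ → ∀ i, ∀ α ∈ Set.Ioo (0 : ℝ) 1,
      limsup (fun T : ℕ => ((coreRegret ν μ π i T / (T : ℝ) ^ α : ℝ) : EReal)) atTop ≤ 0

end HousingBandit

end

/-! Place the given player last on a cycle in which each player's favourite arm is owned by the next
one. The last player values its favourite arm `σ 0` at 1 and everything else at no more than 1/2, so
it loses at least 1/2 whenever someone else obtains `σ 0`. Every other player `k` values its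
favourite at `1/2 + Δ` and `σ 0` at `1/2`. Raising this single mean to `1/2 + 3/2 * Δ` makes `σ 0`
the favourite of `k`; the cycle then breaks into two, and the core gives `σ 0` to `k`. A uniformly
consistent policy has to tell these two instances apart: `k` holds `σ 0` in `O(√T)` rounds of the
first and in all but `O(√T)` rounds of the second. Only rounds in which `k` alone proposes to `σ 0`
carry information, at most `11 * Δ ^ 2` each, so about `log T / Δ ^ 2` of them are needed in the
first instance (`eventually_log_le_expSole`). This holds for each of the `N - 1` other players, and
no round serves two of them, so the costs to the last player add up (`sum_expSole_le_coreRegret`).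
The information bound is the Donsker–Varadhan inequality `E_ν g ≤ log E_ν' exp g + KL`, in which the
relative entropy of the histories is `coinEntropy q` times the expected number of informative
rounds. `law_change` proves it directly by induction on rounds. On the economic side,
`isCore_altMatching` identifies the core of the alternative. -/

noncomputable section

namespace HousingBandit

/-! ### Change of measure -/

/-- A product measure is affine in each factor. -/
lemma pi_affine {ι : Type*} [Fintype ι] [DecidableEq ι] (m m₁ m₀ : ι → Measure ℝ)
    [∀ i, IsProbabilityMeasure (m i)] [∀ i, IsProbabilityMeasure (m₁ i)]
    [∀ i, IsProbabilityMeasure (m₀ i)] (k : ι) (a b : NNReal)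
    (h₁ : ∀ i, i ≠ k → m₁ i = m i) (h₀ : ∀ i, i ≠ k → m₀ i = m i)
    (hk : m k = a • m₁ k + b • m₀ k) :
    Measure.pi m = a • Measure.pi m₁ + b • Measure.pi m₀ := by
  refine Measure.pi_eq fun s _ => ?_
  have e₁ : ∏ i ∈ Finset.univ.erase k, m₁ i (s i) = ∏ i ∈ Finset.univ.erase k, m i (s i) :=
    Finset.prod_congr rfl fun i hi => by rw [h₁ i (Finset.ne_of_mem_erase hi)]
  have e₀ : ∏ i ∈ Finset.univ.erase k, m₀ i (s i) = ∏ i ∈ Finset.univ.erase k, m i (s i) :=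
    Finset.prod_congr rfl fun i hi => by rw [h₀ i (Finset.ne_of_mem_erase hi)]
  rw [Measure.add_apply, Measure.smul_apply, Measure.smul_apply, Measure.pi_pi, Measure.pi_pi,
    ← Finset.mul_prod_erase _ _ (Finset.mem_univ k), e₁,
    ← Finset.mul_prod_erase _ (fun i => m₀ i (s i)) (Finset.mem_univ k), e₀,
    ← Finset.mul_prod_erase _ (fun i => m i (s i)) (Finset.mem_univ k), hk, Measure.add_apply,
    Measure.smul_apply, Measure.smul_apply, add_mul, smul_mul_assoc, smul_mul_assoc]

/-- Donsker–Varadhan for two coins, fair against bias `q`. It is AM-GM for `q * exp A` and `(1 - q)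
* exp B`, and the additive constant is the relative entropy. -/
lemma half_add_le_log {q : ℝ} (h0 : 0 < q) (h1 : q < 1) (A B : ℝ) :
    (A + B) / 2 ≤
      Real.log (q * Real.exp A + (1 - q) * Real.exp B) + (-(Real.log (4 * q * (1 - q)) / 2)) := by
  have h1' : 0 < 1 - q := by linarith
  have hA := Real.exp_pos A
  have hB := Real.exp_pos B
  have key : Real.log ((4 * q * (1 - q)) * (Real.exp A * Real.exp B)) ≤
      Real.log ((q * Real.exp A + (1 - q) * Real.exp B) ^ 2) := by
    refine Real.log_le_log (by positivity) ?_
    nlinarith [sq_nonneg (q * Real.exp A - (1 - q) * Real.exp B)]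
  rw [Real.log_mul (by positivity) (by positivity), Real.log_mul hA.ne' hB.ne', Real.log_exp,
    Real.log_exp, Real.log_pow] at key
  push_cast at key
  linarith

lemma integral_le_log_integral_exp {Ω : Type*} [MeasurableSpace Ω] (P : Measure Ω)
    [IsProbabilityMeasure P] {g : Ω → ℝ} (hg : Measurable g) {M : ℝ} (hM : ∀ x, |g x| ≤ M) :
    ∫ x, g x ∂P ≤ Real.log (∫ x, Real.exp (g x) ∂P) := by
  have hi : Integrable g P := .of_bound hg.aestronglyMeasurable M (.of_forall hM)
  have he : Integrable (fun x => Real.exp (g x)) P :=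
    .of_bound hg.exp.aestronglyMeasurable (Real.exp M) (.of_forall fun x => by
      rw [Real.norm_eq_abs, abs_of_pos (Real.exp_pos _)]
      exact Real.exp_le_exp.2 ((le_abs_self _).trans (hM x)))
  have := convexOn_exp.map_integral_le (μ := P) Real.continuous_exp.continuousOn isClosed_univ
    (.of_forall fun _ => Set.mem_univ _) hi he
  rw [Real.le_log_iff_exp_le (integral_exp_pos he)]
  exact this

/-- The log-exponential mean inherits the bound `M`, so the same `M` serves when rounds are averaged
out one after another. -/
lemma exp_bounds_integral {Ω : Type*} [MeasurableSpace Ω] (P : Measure Ω)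
    [IsProbabilityMeasure P] {g : Ω → ℝ} (hg : Measurable g) {M : ℝ} (hM : ∀ x, |g x| ≤ M) :
    Integrable (fun x => Real.exp (g x)) P ∧ |Real.log (∫ x, Real.exp (g x) ∂P)| ≤ M := by
  have he : Integrable (fun x => Real.exp (g x)) P :=
    .of_bound hg.exp.aestronglyMeasurable (Real.exp M) (.of_forall fun x => by
      rw [Real.norm_eq_abs, abs_of_pos (Real.exp_pos _)]
      exact Real.exp_le_exp.2 ((le_abs_self _).trans (hM x)))
  have hpos := integral_exp_pos he
  refine ⟨he, abs_le.2 ⟨?_, ?_⟩⟩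
  · rw [Real.le_log_iff_exp_le hpos]
    have := integral_mono (integrable_const (Real.exp (-M))) he (fun x =>
      Real.exp_le_exp.2 (abs_le.1 (hM x)).1)
    simpa using this
  · rw [Real.log_le_iff_le_exp hpos]
    have := integral_mono he (integrable_const (Real.exp M)) (fun x =>
      Real.exp_le_exp.2 (abs_le.1 (hM x)).2)
    simpa using this

/-- Player `k` is the only one who proposes to arm `j`. -/
def Sole {N : ℕ} (a : Profile N) (k j : Fin N) : Prop :=
  a k = some j ∧ ∀ l, l ≠ k → a l ≠ some j

open Classical in
/-- Indicator of `Sole`. -/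
def soleInd {N : ℕ} (k j : Fin N) (a : Profile N) : ℝ := if Sole a k j then 1 else 0

lemma rewardLaw_of_sole {N : ℕ} (ν : Env N) {a : Profile N} {k j : Fin N} (h : Sole a k j) :
    rewardLaw ν a k = (ν k j : Measure ℝ) := by
  unfold rewardLaw
  rw [h.1]
  simp only
  rw [if_pos h.2]

lemma rewardLaw_of_not_sole {N : ℕ} (ν : Env N) {a : Profile N} {k : Fin N}
    (h : ∀ j, ¬ Sole a k j) : rewardLaw ν a k = Measure.dirac 0 := by
  unfold rewardLaw
  split
  · rfl
  · next j hj => rw [if_neg fun h' => h j ⟨hj, h'⟩]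

lemma rewardLaw_congr {N : ℕ} {ν ν' : Env N} {a : Profile N} {k : Fin N}
    (h : ∀ j, Sole a k j → ν k j = ν' k j) : rewardLaw ν a k = rewardLaw ν' a k := by
  by_cases hs : ∃ j, Sole a k j
  · obtain ⟨j, hj⟩ := hs
    rw [rewardLaw_of_sole _ hj, rewardLaw_of_sole _ hj, h j hj]
  · rw [rewardLaw_of_not_sole _ (not_exists.1 hs), rewardLaw_of_not_sole _ (not_exists.1 hs)]

lemma rewardKernel_apply {N : ℕ} (ν : Env N) (a : Profile N) :
    rewardKernel ν a = Measure.pi fun i => rewardLaw ν a i := rfl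

/-- Integral against the reward kernel, when the reward of one player is Bernoulli. -/
lemma integral_rewardKernel_of_sole {N : ℕ} {ν : Env N} {a : Profile N} {k j : Fin N}
    (h : Sole a k j) {p : unitInterval} (hp : (ν k j : Measure ℝ) = bernoulliMeasure (1 : ℝ) 0 p)
    {g : (Fin N → ℝ) → ℝ} (hg : Measurable g) {M : ℝ} (hM : ∀ x, |g x| ≤ M) :
    ∫ x, g x ∂(rewardKernel ν a) =
      p * ∫ x, g x ∂(Measure.pi fun i => if i = k then Measure.dirac 1 else rewardLaw ν a i) +
      (1 - p) * ∫ x, g x ∂(Measure.pi fun i => if i = k then Measure.dirac 0 else rewardLaw ν a i)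
      := by
  have inst (c : ℝ) : ∀ i, IsProbabilityMeasure
      (if i = k then Measure.dirac c else rewardLaw ν a i) := fun i => by
    split_ifs <;> infer_instance
  have := inst 1
  have := inst 0
  rw [rewardKernel_apply, pi_affine (fun i => rewardLaw ν a i)
    (fun i => if i = k then Measure.dirac 1 else rewardLaw ν a i)
    (fun i => if i = k then Measure.dirac 0 else rewardLaw ν a i) k
    (unitInterval.toNNReal p) (unitInterval.toNNReal (unitInterval.symm p))
    (fun i hi => by simp [hi]) (fun i hi => by simp [hi])
    (by simp [rewardLaw_of_sole ν h, hp, bernoulliMeasure_def])]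
  have hb (P : Measure (Fin N → ℝ)) [IsFiniteMeasure P] : Integrable g P :=
    .of_bound hg.aestronglyMeasurable M (.of_forall hM)
  rw [integral_add_measure (hb _) (hb _), integral_smul_nnreal_measure,
    integral_smul_nnreal_measure]
  rfl

/-- `ν'` differs from `ν` only in the reward law of player `k` at arm `j`, which is a fair coin under
`ν` and a coin with bias `q` under `ν'`. -/
structure CoinChange {N : ℕ} (ν ν' : Env N) (k j : Fin N) (q : unitInterval) : Prop where
  eq_of_ne : ∀ i l, (i ≠ k ∨ l ≠ j) → ν i l = ν' i l
  fair : ∃ p : unitInterval, (p : ℝ) = 1 / 2 ∧ (ν k j : Measure ℝ) = bernoulliMeasure (1 : ℝ) 0 p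
  biased : (ν' k j : Measure ℝ) = bernoulliMeasure (1 : ℝ) 0 q
  pos : 0 < (q : ℝ)
  lt_one : (q : ℝ) < 1

/-- Relative entropy of a fair coin with respect to a coin with bias `q`. -/
def coinEntropy (q : ℝ) : ℝ := -(Real.log (4 * q * (1 - q)) / 2)

/-- Conditioning on the reward of `k` leaves the same two measures `P₁`, `P₀` under both instances,
with weights `1/2, 1/2` against `q, 1 - q`. Jensen inside each and the two-coin inequality across
them give the bound. If `k` is not alone at `j`, the reward laws coincide and Jensen suffices. -/
lemma rewardKernel_change {N : ℕ} {ν ν' : Env N} {k j : Fin N} {q : unitInterval}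
    (hc : CoinChange ν ν' k j q) (a : Profile N)
    {g : (Fin N → ℝ) → ℝ} (hg : Measurable g) {M : ℝ} (hM : ∀ x, |g x| ≤ M) :
    ∫ x, g x ∂(rewardKernel ν a) ≤
      Real.log (∫ x, Real.exp (g x) ∂(rewardKernel ν' a)) + coinEntropy q * soleInd k j a := by
  by_cases h : Sole a k j
  · have hother : ∀ i, i ≠ k → rewardLaw ν a i = rewardLaw ν' a i := fun i hi =>
      rewardLaw_congr fun l _ => hc.eq_of_ne i l (.inl hi)
    obtain ⟨p, hp, hp'⟩ := hc.fair
    have inst (c : ℝ) : ∀ i, IsProbabilityMeasure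
        (if i = k then Measure.dirac c else rewardLaw ν' a i) := fun i => by
      split_ifs <;> infer_instance
    have i1 := inst 1
    have i0 := inst 0
    have e (c : ℝ) : (fun i => if i = k then Measure.dirac c else rewardLaw ν a i) =
        fun i => if i = k then Measure.dirac c else rewardLaw ν' a i := by
      funext i
      split_ifs with hi
      · rfl
      · exact hother i hi
    have he : ∀ x, |Real.exp (g x)| ≤ Real.exp M := fun x => by
      rw [abs_of_pos (Real.exp_pos _)]
      exact Real.exp_le_exp.2 ((le_abs_self _).trans (hM x))
    rw [integral_rewardKernel_of_sole h hp' hg hM, e, e,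
      integral_rewardKernel_of_sole h hc.biased hg.exp he, hp, soleInd, if_pos h, mul_one]
    set P₁ := Measure.pi fun i => if i = k then Measure.dirac 1 else rewardLaw ν' a i
    set P₀ := Measure.pi fun i => if i = k then Measure.dirac 0 else rewardLaw ν' a i
    have hJ (P : Measure (Fin N → ℝ)) [IsProbabilityMeasure P] :
        Real.exp (∫ x, g x ∂P) ≤ ∫ x, Real.exp (g x) ∂P := by
      rw [← Real.le_log_iff_exp_le (integral_exp_pos (exp_bounds_integral P hg hM).1)]
      exact integral_le_log_integral_exp P hg hM
    have h1q : 0 < 1 - (q : ℝ) := by linarith [hc.lt_one]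
    have h2 := half_add_le_log hc.pos hc.lt_one (∫ x, g x ∂P₁) (∫ x, g x ∂P₀)
    have h3 : Real.log (q * Real.exp (∫ x, g x ∂P₁) + (1 - q) * Real.exp (∫ x, g x ∂P₀)) ≤
        Real.log (q * ∫ x, Real.exp (g x) ∂P₁ + (1 - q) * ∫ x, Real.exp (g x) ∂P₀) := by
      have := hc.pos
      refine Real.log_le_log (by positivity) ?_
      gcongr
      · exact hJ P₁
      · exact hJ P₀
    unfold coinEntropy
    linarith
  · have : rewardKernel ν a = rewardKernel ν' a := by
      rw [rewardKernel_apply, rewardKernel_apply]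
      congr 1
      funext i
      refine rewardLaw_congr fun l hl => hc.eq_of_ne i l ?_
      by_contra! hh
      exact h (by rwa [hh.1, hh.2] at hl)
    rw [soleInd, if_neg h, mul_zero, add_zero, this]
    exact integral_le_log_integral_exp _ hg hM


/-! ### Integration over rounds and histories -/

section

variable {N : ℕ}

lemma measurable_profile {β : Type*} [MeasurableSpace β] (f : Profile N → β) : Measurable f :=
  fun _ _ => trivial

lemma measurable_soleInd (k j : Fin N) : Measurable fun r : Round N => soleInd k j r.1 :=
  (measurable_profile (soleInd k j)).comp measurable_fst

lemma integrable_step {ν : Env N} (π : Policy N) (T : ℕ) {t : ℕ} (h : History N t)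
    {f : Round N → ℝ} (hf : Measurable f)
    (hi : ∀ a, Integrable (fun x => f (a, x)) (rewardKernel ν a)) :
    Integrable f (stepKernel ν π T t h) := by
  unfold stepKernel
  rw [ProbabilityTheory.integrable_compProd_iff hf.aestronglyMeasurable]
  exact ⟨.of_forall fun a => hi a, .of_finite⟩

lemma integral_step {ν : Env N} (π : Policy N) (T : ℕ) {t : ℕ} (h : History N t)
    {f : Round N → ℝ} (hf : Measurable f)
    (hi : ∀ a, Integrable (fun x => f (a, x)) (rewardKernel ν a)) :
    ∫ r, f r ∂(stepKernel ν π T t h) =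
      ∫ a, ∫ x, f (a, x) ∂(rewardKernel ν a) ∂(π.kernel T t h) :=
  ProbabilityTheory.integral_compProd (integrable_step π T h hf hi)

/-- The proposals have the same law under both instances, so averaging over them costs only one more
use of Jensen and no entropy. -/
lemma step_change {ν ν' : Env N} {k j : Fin N} {q : unitInterval}
    (hc : CoinChange ν ν' k j q) (π : Policy N) (T : ℕ) {t : ℕ} (h : History N t)
    {g : Round N → ℝ} (hg : Measurable g) {M : ℝ} (hM : ∀ x, |g x| ≤ M) :
    ∫ r, g r ∂(stepKernel ν π T t h) ≤
      Real.log (∫ r, Real.exp (g r) ∂(stepKernel ν' π T t h)) +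
        coinEntropy q * ∫ r, soleInd k j r.1 ∂(stepKernel ν π T t h) := by
  have hga (a : Profile N) : Measurable fun x => g (a, x) := hg.comp measurable_prodMk_left
  have hb (a : Profile N) := exp_bounds_integral (rewardKernel ν' a) (hga a) (fun x => hM (a, x))
  have hpos (a : Profile N) := integral_exp_pos (hb a).1
  rw [integral_step π T h hg fun a =>
      .of_bound (hga a).aestronglyMeasurable M (.of_forall fun x => hM (a, x)),
    integral_step π T h hg.exp fun a => (hb a).1,
    integral_step π T h (f := fun r => soleInd k j r.1)
      (measurable_soleInd k j) fun a => integrable_const (soleInd k j a)]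
  simp only [integral_const, probReal_univ, one_smul]
  have h1 := integral_le_log_integral_exp (π.kernel T t h)
    (g := fun a => Real.log (∫ x, Real.exp (g (a, x)) ∂(rewardKernel ν' a)))
    (measurable_profile _) (fun a => (hb a).2)
  simp only [Real.exp_log (hpos _)] at h1
  rw [← integral_const_mul]
  refine le_trans ?_ (add_le_add_left h1 _)
  rw [← integral_add .of_finite .of_finite]
  exact integral_mono .of_finite .of_finite fun a => rewardKernel_change hc a (hga a)
    (fun x => hM (a, x))

lemma integrable_integral_step {ν : Env N} {π : Policy N} {T t : ℕ} {f : History N t × Round N → ℝ}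
    (hf : Integrable f (law ν π T t ⊗ₘ stepKernel ν π T t)) :
    Integrable (fun h => ∫ r, f (h, r) ∂(stepKernel ν π T t h)) (law ν π T t) :=
  Integrable.integral_compProd (κ := Kernel.const Unit (law ν π T t))
    (η := Kernel.prodMkLeft Unit (stepKernel ν π T t)) (a := ()) hf

lemma integral_law_succ (ν : Env N) (π : Policy N) (T t : ℕ) {g : History N (t + 1) → ℝ}
    (hg : Measurable g)
    (hi : Integrable (fun p => g (extend p)) (law ν π T t ⊗ₘ stepKernel ν π T t)) :
    ∫ h, g h ∂(law ν π T (t + 1)) =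
      ∫ h, ∫ r, g (extend (h, r)) ∂(stepKernel ν π T t h) ∂(law ν π T t) := by
  rw [law, integral_map measurable_extend.aemeasurable hg.aestronglyMeasurable,
    Measure.integral_compProd hi]

lemma integrable_law_round {ν : Env N} (π : Policy N) (T t : ℕ) {f : Round N → ℝ}
    (hf : Measurable f) (hi : ∀ a, Integrable (fun x => f (a, x)) (rewardKernel ν a)) :
    Integrable (fun p : History N t × Round N => f p.2)
      (law ν π T t ⊗ₘ stepKernel ν π T t) := by
  have hm : Measurable fun p : History N t × Round N => f p.2 := hf.comp measurable_snd
  rw [Measure.integrable_compProd_iff hm.aestronglyMeasurable]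
  refine ⟨.of_forall fun h => integrable_step π T h hf hi, ?_⟩
  -- Rewards need not be bounded, but there are finitely many profiles, so their conditional
  -- absolute means are uniformly bounded.
  obtain ⟨B, hB⟩ := Finite.exists_le fun a => ∫ x, ‖f (a, x)‖ ∂(rewardKernel ν a)
  refine .of_bound (StronglyMeasurable.integral_kernel hf.norm.stronglyMeasurable).aestronglyMeasurable B
    (.of_forall fun h => ?_)
  rw [Real.norm_of_nonneg (integral_nonneg fun _ => norm_nonneg _),
    integral_step π T h hf.norm fun a => (hi a).norm]
  calc _ ≤ ∫ _, B ∂(π.kernel T t h) := integral_mono .of_finite (integrable_const _) hB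
    _ = B := by simp

lemma integrable_law_sum {ν : Env N} (π : Policy N) (T : ℕ) {f : Round N → ℝ}
    (hf : Measurable f) (hi : ∀ a, Integrable (fun x => f (a, x)) (rewardKernel ν a)) (t : ℕ) :
    Integrable (fun h : History N t => ∑ s, f (h s)) (law ν π T t) := by
  induction t with
  | zero => simp
  | succ t ih =>
    rw [law, integrable_map_measure ?_ measurable_extend.aemeasurable]
    · have e : ((fun h : History N (t + 1) => ∑ s, f (h s)) ∘ extend) =
          fun p : History N t × Round N => (∑ s, f (p.1 s)) + f p.2 := by
        funext p
        simp [Fin.sum_univ_castSucc, extend]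
      rw [e]
      refine Integrable.add ?_ (integrable_law_round π T t hf hi)
      rw [← Measure.fst_compProd (law ν π T t) (stepKernel ν π T t)] at ih
      exact ih.comp_measurable measurable_fst
    · exact (Finset.measurable_sum _ fun s _ => hf.comp (measurable_pi_apply s)).aestronglyMeasurable

lemma integral_law_sum_succ {ν : Env N} (π : Policy N) (T : ℕ) {f : Round N → ℝ}
    (hf : Measurable f) (hi : ∀ a, Integrable (fun x => f (a, x)) (rewardKernel ν a)) (t : ℕ) :
    ∫ h, ∑ s, f (h s) ∂(law ν π T (t + 1)) =
      ∫ h, ∑ s, f (h s) ∂(law ν π T t) +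
        ∫ h, ∫ r, f r ∂(stepKernel ν π T t h) ∂(law ν π T t) := by
  have hm : Measurable fun h : History N (t + 1) => ∑ s, f (h s) :=
    Finset.measurable_sum _ fun s _ => hf.comp (measurable_pi_apply s)
  have hI := integrable_law_sum π T hf hi (t + 1)
  rw [law, integrable_map_measure hm.aestronglyMeasurable measurable_extend.aemeasurable] at hI
  rw [integral_law_succ ν π T t hm hI, ← integral_add (integrable_law_sum π T hf hi t)
    (integrable_integral_step (integrable_law_round π T t hf hi))]
  refine integral_congr_ae (.of_forall fun h => ?_)
  simp only [Fin.sum_univ_castSucc, extend, Fin.snoc_castSucc, Fin.snoc_last]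
  rw [integral_add (integrable_const _) (integrable_step π T h hf hi)]
  simp

/-- The rewards of a round may be averaged out, given the proposals. -/
lemma integral_law_sum {ν : Env N} (π : Policy N) (T : ℕ) {f : Round N → ℝ}
    (hf : Measurable f) (hi : ∀ a, Integrable (fun x => f (a, x)) (rewardKernel ν a)) (t : ℕ) :
    ∫ h, ∑ s, f (h s) ∂(law ν π T t) =
      ∫ h, ∑ s, (fun r : Round N => ∫ x, f (r.1, x) ∂(rewardKernel ν r.1)) (h s) ∂(law ν π T t) := by
  induction t with
  | zero => simp
  | succ t ih =>
    have hm : Measurable (fun r : Round N => ∫ x, f (r.1, x) ∂(rewardKernel ν r.1)) :=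
      (measurable_profile fun a => ∫ x, f (a, x) ∂(rewardKernel ν a)).comp measurable_fst
    rw [integral_law_sum_succ π T hf hi, integral_law_sum_succ π T hm fun a =>
      integrable_const (∫ x, f (a, x) ∂(rewardKernel ν a)), ih]
    congr 2
    funext h
    rw [integral_step π T h hf hi, integral_step π T h hm fun a =>
      integrable_const (∫ x, f (a, x) ∂(rewardKernel ν a))]
    simp

/-- Expected number of rounds in which `k` is the only player who proposes to `j`. -/
def expSole (ν : Env N) (π : Policy N) (k j : Fin N) (T t : ℕ) : ℝ :=
  ∫ h, ∑ s, (fun r : Round N => soleInd k j r.1) (h s) ∂(law ν π T t)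

/-- The chain rule for relative entropy, as an induction: each round adds `coinEntropy q` times the
probability that `k` is alone at `j`. -/
lemma law_change {ν ν' : Env N} {k j : Fin N} {q : unitInterval}
    (hc : CoinChange ν ν' k j q) (π : Policy N) (T t : ℕ)
    {g : History N t → ℝ} (hg : Measurable g) {M : ℝ} (hM : ∀ x, |g x| ≤ M) :
    ∫ h, g h ∂(law ν π T t) ≤
      Real.log (∫ h, Real.exp (g h) ∂(law ν' π T t)) + coinEntropy q * expSole ν π k j T t := by
  induction t with
  | zero =>
    simp only [expSole, law, Finset.univ_eq_empty, Finset.sum_empty, integral_zero, mul_zero,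
      add_zero]
    exact integral_le_log_integral_exp _ hg hM
  | succ t ih =>
    have hge : Measurable fun p : History N t × Round N => g (extend p) := hg.comp measurable_extend
    have hgh (h : History N t) : Measurable fun r => g (extend (h, r)) :=
      hge.comp measurable_prodMk_left
    have hgi : Integrable (fun p : History N t × Round N => g (extend p))
        (law ν π T t ⊗ₘ stepKernel ν π T t) :=
      .of_bound hge.aestronglyMeasurable M (.of_forall fun x => hM _)
    have hb (h : History N t) :=
      exp_bounds_integral (stepKernel ν' π T t h) (hgh h) (fun r => hM (extend (h, r)))
    have hpos (h : History N t) := integral_exp_pos (hb h).1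
    -- The induction hypothesis is applied to this `G`; `exp G` is the conditional mean of `exp g`
    -- under `ν'`, so its integral is that of `exp g` over `t + 1` rounds.
    set G : History N t → ℝ := fun h =>
      Real.log (∫ r, Real.exp (g (extend (h, r))) ∂(stepKernel ν' π T t h)) with hG
    have hGm : Measurable G := Real.measurable_log.comp
      (StronglyMeasurable.integral_kernel_prod_right'
        (κ := stepKernel ν' π T t) hge.exp.stronglyMeasurable).measurable
    have hstep := ih hGm (fun h => (hb h).2)
    have hS : Integrable (fun h => ∫ r, soleInd k j r.1 ∂(stepKernel ν π T t h)) (law ν π T t) :=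
      integrable_integral_step (integrable_law_round π T t (measurable_soleInd k j)
        fun a => integrable_const (soleInd k j a))
    have hGi : Integrable G (law ν π T t) :=
      .of_bound hGm.aestronglyMeasurable M (.of_forall fun h => (hb h).2)
    rw [integral_law_succ ν π T t hg hgi, integral_law_succ ν' π T t hg.exp
      (exp_bounds_integral _ hge fun x => hM _).1, expSole,
      integral_law_sum_succ π T (measurable_soleInd k j) fun a => integrable_const (soleInd k j a), mul_add,
      ← add_assoc]
    have h1 : ∫ h, ∫ r, g (extend (h, r)) ∂(stepKernel ν π T t h) ∂(law ν π T t) ≤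
        ∫ h, G h + coinEntropy q * ∫ r, soleInd k j r.1 ∂(stepKernel ν π T t h) ∂(law ν π T t) :=
      integral_mono (integrable_integral_step hgi) (hGi.add (hS.const_mul _))
        fun h => step_change hc π T h (hgh h) fun r => hM _
    rw [integral_add hGi (hS.const_mul _), integral_const_mul] at h1
    simp only [hG, Real.exp_log (hpos _)] at hstep
    simp only [expSole] at hstep
    linarith


/-! ### Bernoulli instances and regret -/

/-- The instance with Bernoulli rewards of means `U`. -/
def bernEnv (U : Fin N → Fin N → ℝ) : Env N := fun i j =>
  ⟨bernoulliMeasure (1 : ℝ) 0 (Set.projIcc (0 : ℝ) 1 zero_le_one (U i j)), inferInstance⟩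

lemma integrable_bernoulli (p : unitInterval) :
    Integrable (fun x : ℝ => x) (bernoulliMeasure (1 : ℝ) 0 p) := by
  rw [bernoulliMeasure_def]
  exact ((integrable_dirac (by simp)).smul_measure_nnreal).add_measure
    ((integrable_dirac (by simp)).smul_measure_nnreal)

lemma bernEnv_mem (U : Fin N → Fin N → ℝ) (i j : Fin N) : bernEnv U i j ∈ bernoulliLaws :=
  ⟨_, rfl⟩

lemma utility_bernEnv {U : Fin N → Fin N → ℝ} (hU : ∀ i j, U i j ∈ Set.Icc (0 : ℝ) 1) :
    utility (bernEnv U) = U := by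
  funext i j
  have : utility (bernEnv U) i j =
      ∫ x, x ∂(bernoulliMeasure (1 : ℝ) 0 (Set.projIcc (0 : ℝ) 1 zero_le_one (U i j))) := rfl
  rw [this, Set.projIcc_of_mem _ (hU i j), integral_bernoulliMeasure]
  simp

lemma integrable_rewardLaw {ν : Env N} (hν : ∀ i j, ν i j ∈ bernoulliLaws) (a : Profile N)
    (i : Fin N) : Integrable (fun x : ℝ => x) (rewardLaw ν a i) := by
  by_cases hs : ∃ j, Sole a i j
  · obtain ⟨j, hj⟩ := hs
    obtain ⟨p, hp⟩ := hν i j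
    rw [rewardLaw_of_sole _ hj, hp]
    exact integrable_bernoulli p
  · rw [rewardLaw_of_not_sole _ (not_exists.1 hs)]
    exact integrable_dirac (by simp)

/-- A lower bound of the loss per round gives a lower bound of the regret. -/
lemma integral_le_coreRegret {ν : Env N} (hν : ∀ i j, ν i j ∈ bernoulliLaws)
    (μ : Equiv.Perm (Fin N)) (π : Policy N) (i : Fin N) (T : ℕ) (w : Profile N → ℝ)
    (hw : ∀ a j, Sole a i j → w a + utility ν i j ≤ utility ν i (μ i))
    (hw' : ∀ a, (∀ j, ¬ Sole a i j) → w a ≤ utility ν i (μ i)) :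
    ∫ h, ∑ s, (fun r : Round N => w r.1) (h s) ∂(law ν π T T) ≤ coreRegret ν μ π i T := by
  have hx (a : Profile N) : Integrable (fun x : Fin N → ℝ => x i) (rewardKernel ν a) :=
    (measurePreserving_eval (fun i => rewardLaw ν a i) i).integrable_comp_of_integrable
      (integrable_rewardLaw hν a i)
  have hmean (a : Profile N) : ∫ x : Fin N → ℝ, x i ∂(rewardKernel ν a) =
      ∫ y, y ∂(rewardLaw ν a i) := by
    rw [rewardKernel_apply, ← (measurePreserving_eval (fun i => rewardLaw ν a i) i).map_eq,
      integral_map (measurable_pi_apply i).aemeasurable (by fun_prop)]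
  have hle (a : Profile N) :
      w a + ∫ x : Fin N → ℝ, x i ∂(rewardKernel ν a) ≤ utility ν i (μ i) := by
    rw [hmean]
    by_cases hs : ∃ j, Sole a i j
    · obtain ⟨j, hj⟩ := hs
      rw [rewardLaw_of_sole _ hj]
      exact hw a j hj
    · rw [rewardLaw_of_not_sole _ (not_exists.1 hs)]
      simpa using hw' a (not_exists.1 hs)
  have hm : Measurable fun r : Round N => r.2 i := (measurable_pi_apply i).comp measurable_snd
  have hmw : Measurable fun r : Round N => w r.1 := (measurable_profile w).comp measurable_fst
  have hmm : Measurable fun r : Round N => ∫ x : Fin N → ℝ, x i ∂(rewardKernel ν r.1) :=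
    (measurable_profile fun a => ∫ x : Fin N → ℝ, x i ∂(rewardKernel ν a)).comp measurable_fst
  have key := integral_law_sum π T (f := fun r : Round N => r.2 i) hm (fun a => hx a) T
  have hiw := integrable_law_sum (ν := ν) π T hmw (fun a => integrable_const (w a)) T
  have him := integrable_law_sum (ν := ν) π T hmm
    (fun a => integrable_const (∫ x : Fin N → ℝ, x i ∂(rewardKernel ν a))) T
  have hfin : ∫ h : History N T, (∑ s, w (h s).1 + ∑ s, ∫ x : Fin N → ℝ, x i ∂(rewardKernel ν (h s).1))
      ∂(law ν π T T) ≤ ∫ _ : History N T, T * utility ν i (μ i) ∂(law ν π T T) := by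
    refine integral_mono (hiw.add him) (integrable_const _) fun h => ?_
    calc _ = ∑ s, (w (h s).1 + ∫ x : Fin N → ℝ, x i ∂(rewardKernel ν (h s).1)) :=
          Finset.sum_add_distrib.symm
      _ ≤ ∑ _ : Fin T, utility ν i (μ i) := Finset.sum_le_sum fun s _ => hle _
      _ = T * utility ν i (μ i) := by simp
  rw [integral_add hiw him, integral_const, probReal_univ, one_smul] at hfin
  unfold coreRegret
  linarith

lemma eventually_coreRegret_le {P : Set (ProbabilityMeasure ℝ)} {π : Policy N}
    (hπ : UniformlyConsistent P π) {ν : Env N} (hν : ∀ i j, ν i j ∈ P)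
    (hs : StrictPrefs (utility ν)) {μ : Equiv.Perm (Fin N)} (hμ : IsCore (utility ν) μ)
    (i : Fin N) : ∀ᶠ T : ℕ in atTop, coreRegret ν μ π i T ≤ Real.sqrt T := by
  have h := hπ ν hν hs μ hμ i (1 / 2) ⟨by norm_num, by norm_num⟩
  have h1 := eventually_lt_of_limsup_lt (h.trans_lt (zero_lt_one (α := EReal)))
  filter_upwards [h1, eventually_ge_atTop 1] with T hT hT1
  have hpos : (0 : ℝ) < T := by exact_mod_cast hT1
  have : coreRegret ν μ π i T / (T : ℝ) ^ (1 / 2 : ℝ) < 1 := by exact_mod_cast hT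
  rw [div_lt_one (by positivity), ← Real.sqrt_eq_rpow] at this
  exact this.le

lemma soleInd_nonneg (k j : Fin N) (a : Profile N) : 0 ≤ soleInd k j a := by
  unfold soleInd; split_ifs <;> norm_num

lemma soleInd_le_one (k j : Fin N) (a : Profile N) : soleInd k j a ≤ 1 := by
  unfold soleInd; split_ifs <;> norm_num

lemma integrable_sole_sum (ν : Env N) (π : Policy N) (k j : Fin N) (T t : ℕ) :
    Integrable (fun h : History N t => ∑ s, soleInd k j (h s).1) (law ν π T t) :=
  integrable_law_sum (ν := ν) π T (measurable_soleInd k j)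
    (fun a => integrable_const (soleInd k j a)) t

/-- The chord of the convex function `exp` between `0` and `l`, with `1 - x` enlarged to `1`. -/
lemma exp_mul_le {l x : ℝ} (h0 : 0 ≤ x) (h1 : x ≤ 1) :
    Real.exp (l * x) ≤ 1 + Real.exp l * x := by
  have := convexOn_exp.2 (Set.mem_univ 0) (Set.mem_univ l) (sub_nonneg.2 h1) h0 (by ring)
  simp only [smul_eq_mul, mul_zero, zero_add, Real.exp_zero, mul_one] at this
  rw [mul_comm l x]
  linarith

/-- A matched pair that is rare under `ν` but the rule under `ν'` has to be explored under `ν`. -/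
lemma eventually_log_le_expSole {ν ν' : Env N} {k j : Fin N} {q : unitInterval}
    (hc : CoinChange ν ν' k j q) (π : Policy N) {C C' : ℝ} (hC' : 0 ≤ C')
    (hP : ∀ᶠ T : ℕ in atTop, expSole ν π k j T T ≤ C * Real.sqrt T)
    (hQ : ∀ᶠ T : ℕ in atTop, T - expSole ν' π k j T T ≤ C' * Real.sqrt T) :
    ∀ᶠ T : ℕ in atTop, Real.log T / 8 ≤ coinEntropy q * expSole ν π k j T T := by
  have hsq : Tendsto (fun T : ℕ => Real.sqrt T) atTop atTop :=
    Real.tendsto_sqrt_atTop.comp tendsto_natCast_atTop_atTop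
  have hlog : Tendsto (fun T : ℕ => Real.log T) atTop atTop :=
    Real.tendsto_log_atTop.comp tendsto_natCast_atTop_atTop
  -- The last two thresholds make `C * √T ≤ T / 2` and let `log (1 + C')` absorb at most half of
  -- `log T / 4`, leaving `log T / 8`.
  filter_upwards [hP, hQ, eventually_ge_atTop 1, hsq.eventually_ge_atTop (2 * C),
    hlog.eventually_ge_atTop (8 * Real.log (1 + C'))] with T hP hQ hT1 hTC hTl
  have hT : (0 : ℝ) < T := by exact_mod_cast hT1
  have hsT : 0 < Real.sqrt T := Real.sqrt_pos.2 hT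
  have hss : Real.sqrt T * Real.sqrt T = T := Real.mul_self_sqrt hT.le
  have hl0 : 0 ≤ Real.log T := Real.log_nonneg (by exact_mod_cast hT1)
  -- The test function is `l` times the fraction of rounds without the pair. With `exp l = √T`, its
  -- exponential mean under `ν'` stays below `1 + C'`, while its mean under `ν` is at least `l / 2 =
  -- log T / 4`.
  set l : ℝ := Real.log (Real.sqrt T) with hl
  have hl' : l = Real.log T / 2 := by rw [hl, Real.log_sqrt hT.le]
  have hexp : Real.exp l = Real.sqrt T := Real.exp_log hsT
  set n : History N T → ℝ := fun h => ∑ s, soleInd k j (h s).1 with hn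
  have hn0 (h) : 0 ≤ n h := Finset.sum_nonneg fun s _ => soleInd_nonneg _ _ _
  have hn1 (h) : n h ≤ T :=
    (Finset.sum_le_sum fun s _ => soleInd_le_one k j (h s).1).trans (by simp)
  have hx0 (h) : 0 ≤ 1 - n h / T := sub_nonneg.2 ((div_le_one hT).2 (hn1 h))
  have hx1 (h) : 1 - n h / T ≤ 1 := by linarith [div_nonneg (hn0 h) hT.le]
  have hnm : Measurable n :=
    Finset.measurable_sum _ fun s _ => (measurable_soleInd k j).comp (measurable_pi_apply s)
  have hgm : Measurable fun h => l * (1 - n h / T) :=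
    ((hnm.div_const _).const_sub 1).const_mul l
  have hl00 : 0 ≤ l := by rw [hl']; linarith
  have hgb (h) : |l * (1 - n h / T)| ≤ l := by
    rw [abs_of_nonneg (mul_nonneg hl00 (hx0 h))]
    exact mul_le_of_le_one_right hl00 (hx1 h)
  have hmain := law_change hc π T T hgm hgb
  have hni : Integrable n (law ν π T T) := integrable_sole_sum ν π k j T T
  have hni' : Integrable n (law ν' π T T) := integrable_sole_sum ν' π k j T T
  have hi' : Integrable (fun h => Real.exp l * (1 - n h / T)) (law ν' π T T) :=
    ((integrable_const 1).sub (hni'.div_const T)).const_mul _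
  have e1 : ∫ h, l * (1 - n h / T) ∂(law ν π T T) = l * (1 - expSole ν π k j T T / T) := by
    rw [integral_const_mul, integral_sub (integrable_const _) (hni.div_const _), integral_div]
    simp [expSole, hn]
  have e2 : ∫ h, (1 + Real.exp l * (1 - n h / T)) ∂(law ν' π T T) =
      1 + Real.exp l * (1 - expSole ν' π k j T T / T) := by
    rw [integral_add (integrable_const _) hi',
      integral_const_mul, integral_sub (integrable_const _) (hni'.div_const _), integral_div]
    simp [expSole, hn]
  have e3 : ∫ h, Real.exp (l * (1 - n h / T)) ∂(law ν' π T T) ≤ 1 + C' := by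
    calc _ ≤ ∫ h, (1 + Real.exp l * (1 - n h / T)) ∂(law ν' π T T) :=
          integral_mono (exp_bounds_integral _ hgm hgb).1 ((integrable_const _).add hi')
            fun h => exp_mul_le (hx0 h) (hx1 h)
      _ = 1 + Real.sqrt T * ((T - expSole ν' π k j T T) / T) := by
          rw [e2, hexp]; field_simp
      _ ≤ 1 + Real.sqrt T * (C' * Real.sqrt T / T) := by gcongr
      _ = 1 + C' := by
          rw [show Real.sqrt T * (C' * Real.sqrt T / T) = C' * (Real.sqrt T * Real.sqrt T) / T by ring,
            hss]
          field_simp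
  have e4 : Real.log (∫ h, Real.exp (l * (1 - n h / T)) ∂(law ν' π T T)) ≤ Real.log (1 + C') :=
    Real.log_le_log (integral_exp_pos (exp_bounds_integral _ hgm hgb).1) e3
  have e5 : expSole ν π k j T T / T ≤ 1 / 2 := by
    rw [div_le_iff₀ hT]
    nlinarith
  have e6 : l * (1 / 2) ≤ l * (1 - expSole ν π k j T T / T) := by
    gcongr; linarith
  rw [e1] at hmain
  linarith

end


/-! ### The hard instance -/

/-- A matching that gives everyone a best arm is in the core. -/
lemma isCore_of_forall_le {N : ℕ} {U : Fin N → Fin N → ℝ} {μ : Equiv.Perm (Fin N)}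
    (h : ∀ i j, U i j ≤ U i (μ i)) : IsCore U μ := by
  rintro ⟨S, μ', -, -, i, -, hi⟩
  exact absurd (h i (μ' i)) (not_le.2 hi)

/-- If everyone except `i` gets its unique best arm, and if the arms that `i` prefers to its own
are traded in a set `C` of other players that is closed under the matching, then the matching is in
the core. -/
lemma isCore_of_closed {N : ℕ} {U : Fin N → Fin N → ℝ} {μ : Equiv.Perm (Fin N)} (i : Fin N)
    (htop : ∀ j, j ≠ i → ∀ a, a ≠ μ j → U j a < U j (μ j)) (C : Finset (Fin N))
    (hi : i ∉ C) (hC : ∀ j ∈ C, μ j ∈ C) (hbetter : ∀ a, U i (μ i) < U i a → a ∈ C) :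
    IsCore U μ := by
  rintro ⟨S, ρ, hS, hle, j, hj, hlt⟩
  have heq : ∀ l ∈ S, l ≠ i → ρ l = μ l := fun l hl hli => by
    by_contra hne
    exact absurd (hle l hl) (not_le.2 (htop l hli _ hne))
  have hji : j = i := by
    by_contra hne
    rw [heq j hj hne] at hlt
    exact lt_irrefl _ hlt
  subst hji
  -- Everyone in the coalition except `i` keeps its arm, so `ρ` permutes `C ∩ S`. The improved arm
  -- of `i` lies there and is already taken by a member of `C`.
  have hmaps : ∀ l ∈ C ∩ S, ρ l ∈ C ∩ S := fun l hl => by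
    rw [Finset.mem_inter] at hl ⊢
    have hlj : l ≠ j := fun e => hi (e ▸ hl.1)
    exact ⟨heq l hl.2 hlj ▸ hC l hl.1, hS l hl.2⟩
  have himg : (C ∩ S).image ρ = C ∩ S :=
    Finset.eq_of_subset_of_card_le (Finset.image_subset_iff.2 hmaps)
      (Finset.card_image_of_injective _ ρ.injective).ge
  have hmem : ρ j ∈ C ∩ S := Finset.mem_inter.2 ⟨hbetter _ hlt, hS j hj⟩
  rw [← himg, Finset.mem_image] at hmem
  obtain ⟨l, hl, hlj⟩ := hmem
  rw [ρ.injective hlj] at hl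
  exact hi (Finset.mem_inter.1 hl).1

lemma exists_isRanking {N : ℕ} {u : Fin N → ℝ} (hu : Function.Injective u) :
    ∃ r, IsRanking u r := by
  refine ⟨Tuple.sort fun i => -u i, ?_⟩
  have hm : StrictMono ((fun i => -u i) ∘ Tuple.sort fun i => -u i) :=
    (Tuple.monotone_sort _).strictMono_of_injective
      ((neg_injective.comp hu).comp (Equiv.injective _))
  exact fun a b hab => neg_lt_neg_iff.1 (hm hab)

variable {n : ℕ} (σ : Equiv.Perm (Fin (n + 1))) (Δ : ℝ)

/-- The matching of `σ k` to the arm of `σ (k + 1)`, cyclically. -/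
def cycleMatching : Equiv.Perm (Fin (n + 1)) := (σ.symm.trans (finRotate (n + 1))).trans σ

lemma cycleMatching_apply (p : Fin (n + 1)) :
    cycleMatching σ (σ p) = σ (finRotate (n + 1) p) := by simp [cycleMatching]

lemma cycleMatching_last : cycleMatching σ (σ (Fin.last n)) = σ 0 := by
  rw [cycleMatching_apply, finRotate_last]

/-- Everyone prefers its arm in `cycleMatching σ`, strongly so for the player `σ (Fin.last n)`. The
other arms are ranked by their positions in `σ`. -/
def cycleUtil (j a : Fin (n + 1)) : ℝ :=
  if a = cycleMatching σ j then (if j = σ (Fin.last n) then 1 else 1 / 2 + Δ)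
  else 1 / 2 - ((σ.symm a : Fin (n + 1)) : ℕ) * Δ

/-- In `cycleUtil`, player `k` is made to like the arm `σ 0` best. -/
def altUtil (k j a : Fin (n + 1)) : ℝ :=
  if j = k ∧ a = σ 0 then 1 / 2 + 3 / 2 * Δ else cycleUtil σ Δ j a

variable {σ Δ}

lemma cycleUtil_of_ne {j a : Fin (n + 1)} (h : a ≠ cycleMatching σ j) :
    cycleUtil σ Δ j a = 1 / 2 - ((σ.symm a : Fin (n + 1)) : ℕ) * Δ := if_neg h

lemma cycleUtil_le_half {j a : Fin (n + 1)} (hΔ : 0 < Δ) (h : a ≠ cycleMatching σ j) :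
    cycleUtil σ Δ j a ≤ 1 / 2 := by
  rw [cycleUtil_of_ne h]
  have : (0 : ℝ) ≤ ((σ.symm a : Fin (n + 1)) : ℕ) * Δ := by positivity
  linarith

lemma cycleUtil_top (j : Fin (n + 1)) : cycleUtil σ Δ j (cycleMatching σ j) =
    if j = σ (Fin.last n) then 1 else 1 / 2 + Δ := if_pos rfl

lemma cycleUtil_top_of_ne {j : Fin (n + 1)} (h : j ≠ σ (Fin.last n)) :
    cycleUtil σ Δ j (cycleMatching σ j) = 1 / 2 + Δ := by rw [cycleUtil_top, if_neg h]

lemma le_quarter (hn : 1 ≤ n) (hΔ' : Δ ≤ 1 / (2 * ((n + 1 : ℕ) : ℝ))) : Δ ≤ 1 / 4 := by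
  refine hΔ'.trans ?_
  have : (1 : ℝ) ≤ n := by exact_mod_cast hn
  push_cast
  exact one_div_le_one_div_of_le (by norm_num) (by linarith)

/-- Utilities other than the top one are `1/2` minus distinct integer multiples of `Δ`, and the top
one is at least `1/2 + Δ`. -/
lemma add_gap_le {j a b : Fin (n + 1)} (hΔ : 0 < Δ) (hΔ4 : Δ ≤ 1 / 4) (hab : a ≠ b)
    (h : cycleUtil σ Δ j a ≤ cycleUtil σ Δ j b) :
    cycleUtil σ Δ j a + Δ ≤ cycleUtil σ Δ j b := by
  have htop : 1 / 2 + Δ ≤ cycleUtil σ Δ j (cycleMatching σ j) := by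
    rw [cycleUtil_top]; split_ifs <;> linarith
  by_cases hb : b = cycleMatching σ j
  · have := cycleUtil_le_half hΔ (hb ▸ hab : a ≠ cycleMatching σ j)
    rw [hb]
    linarith
  by_cases ha : a = cycleMatching σ j
  · have := cycleUtil_le_half hΔ hb
    rw [ha] at h
    linarith
  rw [cycleUtil_of_ne ha, cycleUtil_of_ne hb] at h ⊢
  have h1 : ((σ.symm b : Fin (n + 1)) : ℕ) ≤ (σ.symm a : Fin (n + 1)) := by
    by_contra! hlt
    have : (((σ.symm a : Fin (n + 1)) : ℕ) : ℝ) < ((σ.symm b : Fin (n + 1)) : ℕ) := by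
      exact_mod_cast hlt
    nlinarith
  have h2 : ((σ.symm b : Fin (n + 1)) : ℕ) ≠ (σ.symm a : Fin (n + 1)) := fun e =>
    hab (σ.symm.injective (Fin.ext e)).symm
  have h3 : (((σ.symm b : Fin (n + 1)) : ℕ) : ℝ) + 1 ≤ ((σ.symm a : Fin (n + 1)) : ℕ) := by
    exact_mod_cast lt_of_le_of_ne h1 h2
  nlinarith

lemma cycleUtil_mem (hn : 1 ≤ n) (hΔ : 0 < Δ) (hΔ' : Δ ≤ 1 / (2 * ((n + 1 : ℕ) : ℝ)))
    (j a : Fin (n + 1)) : cycleUtil σ Δ j a ∈ Set.Icc (0 : ℝ) 1 := by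
  have h4 := le_quarter hn hΔ'
  unfold cycleUtil
  split_ifs
  · simp
  · constructor <;> linarith
  · have h1 : (0 : ℝ) ≤ ((σ.symm a : Fin (n + 1)) : ℕ) * Δ := by positivity
    have h2 : (((σ.symm a : Fin (n + 1)) : ℕ) : ℝ) ≤ ((n + 1 : ℕ) : ℝ) := by
      exact_mod_cast (σ.symm a).isLt.le
    -- This is where `Δ ≤ 1 / (2N)` is needed in full: it keeps the lowest utility nonnegative.
    have h3 : ((σ.symm a : Fin (n + 1)) : ℕ) * Δ ≤ 1 / 2 := by
      calc _ ≤ ((n + 1 : ℕ) : ℝ) * (1 / (2 * ((n + 1 : ℕ) : ℝ))) := by gcongr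
        _ = 1 / 2 := by field_simp
    constructor <;> linarith

lemma strictPrefs_cycleUtil (hΔ : 0 < Δ) (hΔ4 : Δ ≤ 1 / 4) : StrictPrefs (cycleUtil σ Δ) := by
  intro j a b hab
  by_contra hne
  have := add_gap_le hΔ hΔ4 hne hab.le
  linarith

lemma cycleUtil_lt_top (hΔ : 0 < Δ) (j a : Fin (n + 1))
    (h : a ≠ cycleMatching σ j) : cycleUtil σ Δ j a < cycleUtil σ Δ j (cycleMatching σ j) := by
  have := cycleUtil_le_half hΔ h
  rw [cycleUtil_top]
  split_ifs <;> linarith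

lemma isSTTCB_cycleUtil (hΔ : 0 < Δ) :
    IsSTTCB (cycleUtil σ Δ) (cycleMatching σ) := by
  refine ⟨isCore_of_forall_le fun i j => ?_, cycleUtil_lt_top hΔ, σ, cycleMatching_apply σ⟩
  by_cases h : j = cycleMatching σ i
  · rw [h]
  · exact (cycleUtil_lt_top hΔ i j h).le

lemma isMinGap_cycleUtil (hn : 1 ≤ n) (hΔ : 0 < Δ) (hΔ4 : Δ ≤ 1 / 4) :
    IsMinGap (cycleUtil σ Δ) Δ := by
  constructor
  -- The gap is attained by player `σ 0`, between its favourite at `1/2 + Δ` and its own arm at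
  -- `1/2`. They are consecutive since no arm but the favourite exceeds `1/2`.
  · obtain ⟨r, hr⟩ := exists_isRanking (strictPrefs_cycleUtil (σ := σ) hΔ hΔ4 (σ 0))
    have h0 : (0 : Fin (n + 1)) ≠ Fin.last n := by
      simp only [ne_eq, Fin.ext_iff, Fin.val_zero, Fin.val_last]; omega
    have htop := cycleUtil_top_of_ne (Δ := Δ) (σ.injective.ne h0)
    have hne : σ 0 ≠ cycleMatching σ (σ 0) := by
      rw [cycleMatching_apply]
      refine σ.injective.ne fun e => ?_
      have := congrArg Fin.val e
      rw [coe_finRotate_of_ne_last h0] at this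
      simp at this
    have hsnd : cycleUtil σ Δ (σ 0) (σ 0) = 1 / 2 := by
      rw [cycleUtil_of_ne hne]; simp
    set k := r.symm (cycleMatching σ (σ 0)) with hk
    set k' := r.symm (σ 0) with hk'
    have ek : r k = cycleMatching σ (σ 0) := by simp [hk]
    have ek' : r k' = σ 0 := by simp [hk']
    have hlt : k < k' := by
      rw [← hr.lt_iff_gt, ek, ek', htop, hsnd]
      linarith
    have hlast : (k : ℕ) + 1 < n + 1 := lt_of_le_of_lt hlt k'.isLt
    refine ⟨σ 0, r, hr, k, k', ?_, ?_⟩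
    · refine le_antisymm ?_ hlt
      have hnext : r ⟨k + 1, hlast⟩ ≠ cycleMatching σ (σ 0) := fun e => by
        rw [← ek] at e
        have := congrArg Fin.val (r.injective e)
        simp at this
      have := cycleUtil_le_half hΔ hnext
      have hv : cycleUtil σ Δ (σ 0) (r k') = 1 / 2 := by rw [ek', hsnd]
      by_contra hlt'
      rw [not_le] at hlt'
      exact absurd (hr (a := ⟨k + 1, hlast⟩) (b := k') hlt') (not_lt.2 (this.trans hv.ge))
    · rw [ek, ek', htop, hsnd]; ring
  · rintro δ ⟨j, r, hr, k, k', hkk, rfl⟩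
    have hlt : k < k' := by rw [Fin.lt_def]; omega
    have := add_gap_le hΔ hΔ4 (r.injective.ne hlt.ne') (hr hlt).le
    linarith

/-! ### The alternative instance and its core -/

section Alternative

variable {k : Fin (n + 1)}

lemma altUtil_of_ne {j a : Fin (n + 1)} (h : j ≠ k ∨ a ≠ σ 0) :
    altUtil σ Δ k j a = cycleUtil σ Δ j a := if_neg (by tauto)

lemma altUtil_self : altUtil σ Δ k k (σ 0) = 1 / 2 + 3 / 2 * Δ := if_pos ⟨rfl, rfl⟩

lemma altUtil_le (hΔ : 0 < Δ) (hk : k ≠ σ (Fin.last n)) {a : Fin (n + 1)} (h : a ≠ σ 0) :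
    altUtil σ Δ k k a ≤ 1 / 2 + Δ := by
  rw [altUtil_of_ne (.inr h)]
  by_cases ha : a = cycleMatching σ k
  · rw [ha, cycleUtil_top_of_ne hk]
  · linarith [cycleUtil_le_half hΔ ha]

lemma zero_ne_cycleMatching (hk : k ≠ σ (Fin.last n)) : σ 0 ≠ cycleMatching σ k := fun h =>
  hk ((cycleMatching σ).injective ((cycleMatching_last σ).trans h)).symm

lemma cycleUtil_zero (hk : k ≠ σ (Fin.last n)) : cycleUtil σ Δ k (σ 0) = 1 / 2 := by
  rw [cycleUtil_of_ne (zero_ne_cycleMatching hk)]; simp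

lemma altUtil_mem (hn : 1 ≤ n) (hΔ : 0 < Δ) (hΔ' : Δ ≤ 1 / (2 * ((n + 1 : ℕ) : ℝ)))
    (j a : Fin (n + 1)) : altUtil σ Δ k j a ∈ Set.Icc (0 : ℝ) 1 := by
  have h4 := le_quarter hn hΔ'
  unfold altUtil
  split_ifs
  · constructor <;> linarith
  · exact cycleUtil_mem hn hΔ hΔ' j a

lemma strictPrefs_altUtil (hΔ : 0 < Δ) (hΔ4 : Δ ≤ 1 / 4) (hk : k ≠ σ (Fin.last n)) :
    StrictPrefs (altUtil σ Δ k) := by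
  intro j a b hab
  have hinj := strictPrefs_cycleUtil (σ := σ) hΔ hΔ4 j
  by_cases hj : j = k
  · subst hj
    by_cases ha : a = σ 0 <;> by_cases hb : b = σ 0
    · rw [ha, hb]
    · have := altUtil_le hΔ hk hb
      rw [← hab, ha, altUtil_self] at this
      linarith
    · have := altUtil_le hΔ hk ha
      rw [hab, hb, altUtil_self] at this
      linarith
    · rw [altUtil_of_ne (.inr ha), altUtil_of_ne (.inr hb)] at hab
      exact hinj hab
  · rw [altUtil_of_ne (.inl hj), altUtil_of_ne (.inl hj)] at hab
    exact hinj hab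

variable (σ k) in
/-- The core matching of `altUtil σ Δ k`. -/
def altMatching : Equiv.Perm (Fin (n + 1)) :=
  (Equiv.swap (σ (Fin.last n)) k).trans (cycleMatching σ)

lemma altMatching_self : altMatching σ k k = σ 0 := by
  simp [altMatching, cycleMatching_last]

lemma altMatching_last : altMatching σ k (σ (Fin.last n)) = cycleMatching σ k := by
  simp [altMatching]

lemma altMatching_of_ne {j : Fin (n + 1)} (h : j ≠ σ (Fin.last n)) (h' : j ≠ k) :
    altMatching σ k j = cycleMatching σ j := by
  simp [altMatching, Equiv.swap_apply_of_ne_of_ne h h']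

/-- The swap cuts the cycle after `k`. Positions up to that of `k` form a closed cycle of their own,
and these contain every arm that the last player prefers to the one it now gets, since it ranks the
arms other than its favourite `σ 0` by position. -/
lemma isCore_altMatching (hΔ : 0 < Δ) (hk : k ≠ σ (Fin.last n)) :
    IsCore (altUtil σ Δ k) (altMatching σ k) := by
  have hkl : σ.symm k ≠ Fin.last n := fun e => hk (by rw [← e]; simp)
  have hklt : σ.symm k < Fin.last n := lt_of_le_of_ne (Fin.le_last _) hkl
  refine isCore_of_closed (σ (Fin.last n)) ?_ (Finset.univ.filter fun j => σ.symm j ≤ σ.symm k)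
    (by simpa using hkl) ?_ ?_
  · intro j hj a ha
    by_cases hjk : j = k
    · subst hjk
      rw [altMatching_self] at ha ⊢
      have := altUtil_le hΔ hk ha
      rw [altUtil_self]
      linarith
    · rw [altMatching_of_ne hj hjk] at ha ⊢
      rw [altUtil_of_ne (.inl hjk), altUtil_of_ne (.inl hjk)]
      exact cycleUtil_lt_top hΔ j a ha
  · intro j hj
    rw [Finset.mem_filter] at hj ⊢
    refine ⟨Finset.mem_univ _, ?_⟩
    by_cases hjk : j = k
    · rw [hjk, altMatching_self]; simp
    · have hlt : σ.symm j < σ.symm k := lt_of_le_of_ne hj.2 (σ.symm.injective.ne hjk)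
      have hjl : σ.symm j ≠ Fin.last n := (hlt.trans hklt).ne
      have hj' : j ≠ σ (Fin.last n) := fun e => hjl (by rw [e]; simp)
      rw [altMatching_of_ne hj' hjk, ← σ.apply_symm_apply j, cycleMatching_apply,
        Equiv.symm_apply_apply, Fin.le_def, coe_finRotate_of_ne_last hjl]
      exact hlt
  · intro a ha
    rw [Finset.mem_filter]
    refine ⟨Finset.mem_univ _, ?_⟩
    rw [altMatching_last, altUtil_of_ne (.inl hk.symm), altUtil_of_ne (.inl hk.symm)] at ha
    by_cases hal : a = cycleMatching σ (σ (Fin.last n))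
    · rw [hal, cycleMatching_last]; simp
    · rw [cycleUtil_of_ne hal, cycleUtil_of_ne ((cycleMatching σ).injective.ne hk)] at ha
      have h1 : (((σ.symm a : Fin (n + 1)) : ℕ) : ℝ) <
          ((σ.symm (cycleMatching σ k) : Fin (n + 1)) : ℕ) := by
        by_contra! hge
        nlinarith
      rw [← σ.apply_symm_apply k, cycleMatching_apply, Equiv.symm_apply_apply,
        coe_finRotate_of_ne_last hkl] at h1
      have h2 : ((σ.symm a : Fin (n + 1)) : ℕ) < (σ.symm k : Fin (n + 1)) + 1 := by exact_mod_cast h1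
      rw [Fin.le_def]
      omega

end Alternative


/-! ### The lower bound -/

lemma soleInd_of_not {N : ℕ} {k j : Fin N} {a : Profile N} (h : ¬ Sole a k j) :
    soleInd k j a = 0 := if_neg h

lemma sum_soleInd_le_one {N : ℕ} (s : Finset (Fin N)) (j : Fin N) (a : Profile N) :
    ∑ k ∈ s, soleInd k j a ≤ 1 := by
  by_cases h : ∃ k ∈ s, Sole a k j
  · obtain ⟨k, hk, hks⟩ := h
    rw [Finset.sum_eq_single_of_mem k hk fun l _ hl => soleInd_of_not fun hls => hks.2 l hl hls.1]
    exact soleInd_le_one k j a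
  · push Not at h
    rw [Finset.sum_eq_zero fun k hk => soleInd_of_not (h k hk)]
    exact zero_le_one

lemma expSole_nonneg {N : ℕ} (ν : Env N) (π : Policy N) (k j : Fin N) (T t : ℕ) :
    0 ≤ expSole ν π k j T t :=
  integral_nonneg fun _ => Finset.sum_nonneg fun _ _ => soleInd_nonneg _ _ _

lemma coinEntropy_le {Δ : ℝ} (hΔ4 : |Δ| ≤ 1 / 4) :
    coinEntropy (1 / 2 + 3 / 2 * Δ) ≤ 11 * Δ ^ 2 := by
  have hsq : Δ ^ 2 ≤ 1 / 16 := by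
    rw [← sq_abs]
    nlinarith [abs_nonneg Δ]
  have hpos : 0 < 1 - 9 * Δ ^ 2 := by linarith
  have hlog := Real.one_sub_inv_le_log_of_pos hpos
  -- `(1 + 22x)(1 - 9x) = 1 + 13x - 198x²` is at least 1 for `0 ≤ x ≤ 1/16`; half of 22 is the final
  -- 11.
  have hinv : (1 - 9 * Δ ^ 2)⁻¹ ≤ 1 + 22 * Δ ^ 2 := by
    rw [inv_le_iff_one_le_mul₀ hpos]
    nlinarith [sq_nonneg Δ]
  have e : 4 * (1 / 2 + 3 / 2 * Δ) * (1 - (1 / 2 + 3 / 2 * Δ)) = 1 - 9 * Δ ^ 2 := by ring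
  rw [coinEntropy, e]
  linarith

variable {k : Fin (n + 1)}

lemma coinChange_altUtil (hΔ : 0 < Δ) (hΔ4 : Δ ≤ 1 / 4)
    (hk : k ≠ σ (Fin.last n)) :
    CoinChange (bernEnv (cycleUtil σ Δ)) (bernEnv (altUtil σ Δ k)) k (σ 0)
      ⟨1 / 2 + 3 / 2 * Δ, by constructor <;> linarith⟩ where
  eq_of_ne i l h := by
    unfold bernEnv
    congr 3
    exact (altUtil_of_ne h).symm
  fair := by
    refine ⟨⟨1 / 2, by norm_num, by norm_num⟩, rfl, ?_⟩
    change bernoulliMeasure (1 : ℝ) 0 (Set.projIcc (0 : ℝ) 1 zero_le_one (cycleUtil σ Δ k (σ 0))) = _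
    rw [cycleUtil_zero hk, Set.projIcc_of_mem _ ⟨by norm_num, by norm_num⟩]
  biased := by
    change bernoulliMeasure (1 : ℝ) 0 (Set.projIcc (0 : ℝ) 1 zero_le_one (altUtil σ Δ k k (σ 0))) = _
    rw [altUtil_self, Set.projIcc_of_mem _ ⟨by linarith, by linarith⟩]
  pos := by
    change 0 < 1 / 2 + 3 / 2 * Δ
    linarith
  lt_one := by
    change 1 / 2 + 3 / 2 * Δ < 1
    linarith

/-- Player `σ (Fin.last n)` loses a constant whenever its arm goes to someone else. -/
lemma sum_expSole_le_coreRegret (hn : 1 ≤ n) (hΔ : 0 < Δ) (hΔ' : Δ ≤ 1 / (2 * ((n + 1 : ℕ) : ℝ)))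
    (π : Policy (n + 1)) (T : ℕ) :
    1 / 2 * ∑ k ∈ Finset.univ.erase (σ (Fin.last n)),
        expSole (bernEnv (cycleUtil σ Δ)) π k (σ 0) T T ≤
      coreRegret (bernEnv (cycleUtil σ Δ)) (cycleMatching σ) π (σ (Fin.last n)) T := by
  have htop : cycleUtil σ Δ (σ (Fin.last n)) (cycleMatching σ (σ (Fin.last n))) = 1 := by
    rw [cycleUtil_top, if_pos rfl]
  refine le_of_eq_of_le ?_ (integral_le_coreRegret (bernEnv_mem _) _ π _ T
    (fun a => 1 / 2 * ∑ k ∈ Finset.univ.erase (σ (Fin.last n)), soleInd k (σ 0) a) ?_ ?_)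
  · simp only [expSole]
    rw [← integral_finsetSum _ fun k _ => integrable_sole_sum _ π k (σ 0) T T, ← integral_const_mul]
    congr 1
    funext h
    rw [Finset.sum_comm, Finset.mul_sum]
  · intro a j hj
    rw [utility_bernEnv (cycleUtil_mem hn hΔ hΔ'), htop]
    -- If the last player itself holds `σ 0`, nobody else does and no loss is claimed; any other arm
    -- yields at most `1/2` instead of `1`.
    by_cases hj0 : j = σ 0
    · have hle := (cycleUtil_mem (σ := σ) hn hΔ hΔ' (σ (Fin.last n)) j).2
      rw [Finset.sum_eq_zero fun k hk => soleInd_of_not fun hks => ?_]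
      · linarith
      · exact hj.2 k (Finset.ne_of_mem_erase hk) (hj0 ▸ hks.1)
    · have hle := cycleUtil_le_half (σ := σ) (j := σ (Fin.last n)) (a := j) hΔ
        (by rwa [cycleMatching_last])
      have := sum_soleInd_le_one (Finset.univ.erase (σ (Fin.last n))) (σ 0) a
      linarith
  · intro a _
    rw [utility_bernEnv (cycleUtil_mem hn hΔ hΔ'), htop]
    have := sum_soleInd_le_one (Finset.univ.erase (σ (Fin.last n))) (σ 0) a
    linarith

/-- Under `altUtil`, player `k` loses `Δ / 2` whenever it is not matched to `σ 0`. -/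
lemma sub_expSole_le_coreRegret (hn : 1 ≤ n) (hΔ : 0 < Δ) (hΔ' : Δ ≤ 1 / (2 * ((n + 1 : ℕ) : ℝ)))
    (hk : k ≠ σ (Fin.last n)) (π : Policy (n + 1)) (T : ℕ) :
    Δ / 2 * (T - expSole (bernEnv (altUtil σ Δ k)) π k (σ 0) T T) ≤
      coreRegret (bernEnv (altUtil σ Δ k)) (altMatching σ k) π k T := by
  refine le_of_eq_of_le ?_ (integral_le_coreRegret (bernEnv_mem _) _ π _ T
    (fun a => Δ / 2 * (1 - soleInd k (σ 0) a)) ?_ ?_)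
  · simp only [← Finset.mul_sum, Finset.sum_sub_distrib]
    rw [integral_const_mul, integral_sub (integrable_const _)
      (integrable_sole_sum _ π k (σ 0) T T)]
    simp [expSole]
  · intro a j hj
    rw [utility_bernEnv (altUtil_mem hn hΔ hΔ'), altMatching_self, altUtil_self]
    by_cases hj0 : j = σ 0
    · rw [hj0] at hj ⊢
      rw [soleInd, if_pos hj, altUtil_self]
      linarith
    · have := altUtil_le hΔ hk hj0
      have := soleInd_nonneg k (σ 0) a
      nlinarith
  · intro a _
    rw [utility_bernEnv (altUtil_mem hn hΔ hΔ'), altMatching_self, altUtil_self]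
    have := soleInd_nonneg k (σ 0) a
    nlinarith

/-- Consistency is used for two different players: the regret of the last one limits the rounds in
which `k` holds `σ 0`, and under the alternative the regret of `k` limits those in which it does
not. The losses per round, `1/2` and `Δ / 2`, give `C = 2` and `C' = 2 / Δ`; `88 = 8 * 11`. -/
lemma eventually_log_le_expSole_cycle (hn : 1 ≤ n) (hΔ : 0 < Δ)
    (hΔ' : Δ ≤ 1 / (2 * ((n + 1 : ℕ) : ℝ))) (hk : k ≠ σ (Fin.last n)) {π : Policy (n + 1)}
    (hπ : UniformlyConsistent bernoulliLaws π) :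
    ∀ᶠ T : ℕ in atTop,
      Real.log T / (88 * Δ ^ 2) ≤ expSole (bernEnv (cycleUtil σ Δ)) π k (σ 0) T T := by
  have hΔ4 := le_quarter hn hΔ'
  have hu := utility_bernEnv (cycleUtil_mem (σ := σ) hn hΔ hΔ')
  have hu' := utility_bernEnv (altUtil_mem (σ := σ) (k := k) hn hΔ hΔ')
  have hP := eventually_coreRegret_le hπ (bernEnv_mem (cycleUtil σ Δ))
    (by rw [hu]; exact strictPrefs_cycleUtil hΔ hΔ4) (μ := cycleMatching σ)
    (by rw [hu]; exact (isSTTCB_cycleUtil hΔ).1) (σ (Fin.last n))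
  have hQ := eventually_coreRegret_le hπ (bernEnv_mem (altUtil σ Δ k))
    (by rw [hu']; exact strictPrefs_altUtil hΔ hΔ4 hk) (μ := altMatching σ k)
    (by rw [hu']; exact isCore_altMatching hΔ hk) k
  have key := eventually_log_le_expSole (coinChange_altUtil hΔ hΔ4 hk) π (C := 2) (C' := 2 / Δ)
    (by positivity) (hP.mono fun T hT => ?_) (hQ.mono fun T hT => ?_)
  · filter_upwards [key] with T hT
    have h1 : coinEntropy (1 / 2 + 3 / 2 * Δ) ≤ 11 * Δ ^ 2 :=
      coinEntropy_le (by rwa [abs_of_pos hΔ])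
    have h2 := hT.trans (mul_le_mul_of_nonneg_right h1 (expSole_nonneg _ _ _ _ _ _))
    rw [div_le_iff₀ (by positivity)]
    linarith
  · have h1 := sum_expSole_le_coreRegret (σ := σ) hn hΔ hΔ' π T
    have h2 := Finset.single_le_sum
      (f := fun k => expSole (bernEnv (cycleUtil σ Δ)) π k (σ 0) T T)
      (fun l _ => expSole_nonneg _ _ _ _ _ _)
      (Finset.mem_erase.2 ⟨hk, Finset.mem_univ k⟩)
    linarith
  · have h1 := (sub_expSole_le_coreRegret hn hΔ hΔ' hk π T).trans hT
    rw [div_mul_eq_mul_div, le_div_iff₀ hΔ]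
    linarith

lemma eventually_le_coreRegret (hn : 1 ≤ n) (hΔ : 0 < Δ)
    (hΔ' : Δ ≤ 1 / (2 * ((n + 1 : ℕ) : ℝ))) {π : Policy (n + 1)}
    (hπ : UniformlyConsistent bernoulliLaws π) :
    ∀ᶠ T : ℕ in atTop, 1 / 352 * (((n + 1 : ℕ) : ℝ) * Real.log T / Δ ^ 2) ≤
      coreRegret (bernEnv (cycleUtil σ Δ)) (cycleMatching σ) π (σ (Fin.last n)) T := by
  have hall : ∀ᶠ T : ℕ in atTop, ∀ k ∈ Finset.univ.erase (σ (Fin.last n)),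
      Real.log T / (88 * Δ ^ 2) ≤ expSole (bernEnv (cycleUtil σ Δ)) π k (σ 0) T T :=
    (Finset.eventually_all _).2 fun k hk =>
      eventually_log_le_expSole_cycle hn hΔ hΔ' (Finset.ne_of_mem_erase hk) hπ
  filter_upwards [hall, eventually_ge_atTop 1] with T hT hT1
  refine le_trans ?_ (sum_expSole_le_coreRegret hn hΔ hΔ' π T)
  have h1 := Finset.card_nsmul_le_sum _ _ _ hT
  rw [Finset.card_erase_of_mem (Finset.mem_univ _), Finset.card_univ, Fintype.card_fin,
    Nat.add_sub_cancel, nsmul_eq_mul] at h1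
  have hl : 0 ≤ Real.log T / Δ ^ 2 :=
    div_nonneg (Real.log_nonneg (by exact_mod_cast hT1)) (sq_nonneg _)
  have hn' : (1 : ℝ) ≤ n := by exact_mod_cast hn
  have e : Real.log T / (88 * Δ ^ 2) = 1 / 88 * (Real.log T / Δ ^ 2) := by
    field_simp
  rw [e] at h1
  rw [mul_div_assoc]
  push_cast
  -- The factor `1/2` from the loss and `n ≥ (n + 1) / 2` turn `1/88` into `1/352`.
  nlinarith

end HousingBandit

end

theorem corollary1 :
    ∃ c : ℝ, 0 < c ∧
      ∀ N : ℕ, 2 ≤ N → ∀ i : Fin N, ∀ Δ : ℝ, 0 < Δ → Δ ≤ 1 / (2 * (N : ℝ)) →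
        ∃ (ν : HousingBandit.Env N) (μ : Equiv.Perm (Fin N)),
          (∀ k j, ν k j ∈ HousingBandit.bernoulliLaws) ∧
          HousingBandit.StrictPrefs (HousingBandit.utility ν) ∧
          HousingBandit.IsSTTCB (HousingBandit.utility ν) μ ∧
          HousingBandit.IsMinGap (HousingBandit.utility ν) Δ ∧
          ∀ π : HousingBandit.Policy N,
            HousingBandit.UniformlyConsistent HousingBandit.bernoulliLaws π →
            ∀ᶠ T : ℕ in Filter.atTop,
              c * ((N : ℝ) * Real.log T / Δ ^ 2) ≤ HousingBandit.coreRegret ν μ π i T := by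
  refine ⟨1 / 352, by norm_num, fun N hN i Δ hΔ hΔ' => ?_⟩
  obtain ⟨n, rfl⟩ : ∃ n, N = n + 1 := ⟨N - 1, by omega⟩
  have hn : 1 ≤ n := by omega
  have hΔ4 := HousingBandit.le_quarter hn hΔ'
  -- Only the position of `i` at the end of the cycle matters; the order of the others is arbitrary.
  obtain ⟨σ, rfl⟩ : ∃ σ : Equiv.Perm (Fin (n + 1)), σ (Fin.last n) = i :=
    ⟨Equiv.swap (Fin.last n) i, Equiv.swap_apply_left _ _⟩
  have hu := HousingBandit.utility_bernEnv (HousingBandit.cycleUtil_mem (σ := σ) hn hΔ hΔ')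
  refine ⟨HousingBandit.bernEnv (HousingBandit.cycleUtil σ Δ), HousingBandit.cycleMatching σ,
    HousingBandit.bernEnv_mem _, ?_, ?_, ?_, fun π hπ =>
      HousingBandit.eventually_le_coreRegret hn hΔ hΔ' hπ⟩ <;> rw [hu]
  · exact HousingBandit.strictPrefs_cycleUtil hΔ hΔ4
  · exact HousingBandit.isSTTCB_cycleUtil hΔ
  · exact HousingBandit.isMinGap_cycleUtil hn hΔ hΔ4
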